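/- Let $S_{m,n}=a^mb^n+b^mc^n+c^ma^n$, $S_n=a^n+b^n+c^n$, $T_{m,n}=S_{m,n}+S_{n,m}$, $U=abc$, and $$s_0=S_5-US_{1,1},\quad s_1=T_{4,1}-2US_{1,1},\quad s_2=T_{3,2}-2US_{1,1},\quad s_3=US_2-US_{1,1},\quad s_4=US_{1,1}.$$ For $t\ge 2$ put $\mu_R(t)=2-t^2+t\sqrt{(t-1)(t+2)}$ and $\mu_B(t)=\tfrac12\bigl(\mu_R(t)-\sqrt{\mu_R(t)^2-4}\bigr)$; for $u>0$ put $\omega(u)=u+\frac1u-2$. Let $$p_1^B(t,w)=-2w-3,\qquad p_2^B(t,w)=w^2+2w+2,$$ $$p_3^B(t,w)=-\frac{2t^3+4t^2+5t+1}{t^2(t+2)}w^2+\frac{2(4t^2+5t+3)}{t+2}w-\frac{3t^3-7t^2-12t-8}{t+2},$$ $$p_4^B(t,w)=\frac{(t-1)^3\bigl(-w^2-2t^2w+t^2(t-2)\bigr)}{t^2(t+2)},\qquad b_1^B(t,w)=(2t+1)w-t(t-4),$$ and $\mathfrak e^B_{t,u}(a,b,c)=s_0+\sum_{i=1}^4 p_i^B(t,\omega(u))\,s_i$.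 Let $\mathcal P^+_{3,5}$ be the cone of all (not necessarily symmetric) real quintic forms in three variables that are nonnegative on $\{(a,b,c): a,b,c\ge 0\}$, and let $\mathcal P_{3,10}$ be the cone of all real forms of degree $10$ in three variables that are nonnegative on $\mathbb R^3$. A nonzero element $f$ of a convex cone $\mathcal P$ is called extremal in $\mathcal P$ if $g,h\in\mathcal P$ and $g+h=f$ imply that $g$ and $h$ are both nonnegative multiples of $f$. **Theorem.** Suppose $t\ge 2$, $\mu_B(t)\le u<1$ and $b_1^B(t,\omega(u))\ne 0$. Then $\mathfrak e^B_{t,u}$ is extremal in $\mathcal P^+_{3,5}$, and $\mathfrak e^B_{t,u}(a^2,b^2,c^2)$ is extremal in $\mathcal P_{3,10}$. -/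

import Mathlib

open MvPolynomial

noncomputable section

/-- The forms of degree `d` in `n` real variables. -/
def forms (n d : ℕ) : Submodule ℝ (MvPolynomial (Fin n) ℝ) :=
  homogeneousSubmodule (Fin n) ℝ d

/-- The PSD cone on `A` in `H`: the elements of `H` that are nonnegative at every point of `A`. -/
def psdCone {n : ℕ} (A : Set (Fin n → ℝ)) (H : Submodule ℝ (MvPolynomial (Fin n) ℝ)) :
    Set (MvPolynomial (Fin n) ℝ) :=
  {f | f ∈ H ∧ ∀ a ∈ A, 0 ≤ eval a f}

/-- The closed nonnegative orthant. -/
def orthant (n : ℕ) : Set (Fin n → ℝ) := {a | ∀ i, 0 ≤ a i}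

/-- All forms of degree `d` in `n` variables that are nonnegative on the whole space. -/
def psdForms (n d : ℕ) : Set (MvPolynomial (Fin n) ℝ) := psdCone Set.univ (forms n d)

/-- All forms of degree `d` in `n` variables that are nonnegative on the nonnegative orthant. -/
def psdFormsOrthant (n d : ℕ) : Set (MvPolynomial (Fin n) ℝ) := psdCone (orthant n) (forms n d)

/-- The extremal elements of a cone `P`: the nonzero `f ∈ P` such that in every decomposition
`f = g + h` with `g, h ∈ P` both summands are nonnegative multiples of `f`. -/
def extremalElements {E : Type*} [AddCommGroup E] [Module ℝ E] (P : Set E) : Set E :=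
  {f | f ∈ P ∧ f ≠ 0 ∧ ∀ g ∈ P, ∀ h ∈ P, g + h = f →
    (∃ α : ℝ, 0 ≤ α ∧ g = α • f) ∧ (∃ β : ℝ, 0 ≤ β ∧ h = β • f)}

/-- The cyclic sum `a^m b^n + b^m c^n + c^m a^n` in the variables `a = X 0, b = X 1, c = X 2`. -/
def cycS (m n : ℕ) : MvPolynomial (Fin 3) ℝ :=
  X 0 ^ m * X 1 ^ n + X 1 ^ m * X 2 ^ n + X 2 ^ m * X 0 ^ n

/-- `S_{m,n} + S_{n,m}`. -/
def symT (m n : ℕ) : MvPolynomial (Fin 3) ℝ := cycS m n + cycS n m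

/-- The product `abc`. -/
def prodU : MvPolynomial (Fin 3) ℝ := X 0 * X 1 * X 2

/-- The basis `s_0, s_1, s_2, s_3, s_4` of the symmetric quintic forms in three variables
(here `cycS n 0` is the power sum `a^n + b^n + c^n`). -/
def s0 : MvPolynomial (Fin 3) ℝ := cycS 5 0 - prodU * cycS 1 1

def s1 : MvPolynomial (Fin 3) ℝ := symT 4 1 - 2 * (prodU * cycS 1 1)

def s2 : MvPolynomial (Fin 3) ℝ := symT 3 2 - 2 * (prodU * cycS 1 1)

def s3 : MvPolynomial (Fin 3) ℝ := prodU * cycS 2 0 - prodU * cycS 1 1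

def s4 : MvPolynomial (Fin 3) ℝ := prodU * cycS 1 1

def muR (t : ℝ) : ℝ := 2 - t ^ 2 + t * Real.sqrt ((t - 1) * (t + 2))

def muB (t : ℝ) : ℝ := (1 / 2) * (muR t - Real.sqrt (muR t ^ 2 - 4))

def omega (u : ℝ) : ℝ := u + 1 / u - 2

def p1B (_t w : ℝ) : ℝ := -2 * w - 3

def p2B (_t w : ℝ) : ℝ := w ^ 2 + 2 * w + 2

def p3B (t w : ℝ) : ℝ :=
  -((2 * t ^ 3 + 4 * t ^ 2 + 5 * t + 1) / (t ^ 2 * (t + 2))) * w ^ 2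
    + (2 * (4 * t ^ 2 + 5 * t + 3) / (t + 2)) * w
    - (3 * t ^ 3 - 7 * t ^ 2 - 12 * t - 8) / (t + 2)

def p4B (t w : ℝ) : ℝ :=
  (t - 1) ^ 3 * (-w ^ 2 - 2 * t ^ 2 * w + t ^ 2 * (t - 2)) / (t ^ 2 * (t + 2))

/-- The symmetric quintic form `𝔢^B_{t,u}`. -/
def eB (t u : ℝ) : MvPolynomial (Fin 3) ℝ :=
  s0 + p1B t (omega u) • s1 + p2B t (omega u) • s2 + p3B t (omega u) • s3 + p4B t (omega u) • s4

def b1B (t w : ℝ) : ℝ := (2 * t + 1) * w - t * (t - 4)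

/-- The substitution `f(a, b, c) ↦ f(a², b², c²)`. -/
def squareVars (f : MvPolynomial (Fin 3) ℝ) : MvPolynomial (Fin 3) ℝ :=
  aeval (fun i : Fin 3 => (X i ^ 2 : MvPolynomial (Fin 3) ℝ)) f

end

/-! Extremality is a rigidity statement: a form squeezed between `0` and `f = quinticB` on the
orthant must vanish wherever `f` does, together with its partial derivatives in every coordinate
that is positive there (`eq_zero_and_deriv_eq_zero_of_abs_le`). The zeros used are `(1, u, 0)`, `(1,
u⁻¹, 0)`, `(t, 1, 1)` and their permutations. On an edge, double zeros at `u` and `u⁻¹` leave only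
the two end coefficients free; at the interior zeros what remains is a linear system whose
determinant contains `b1B`, so that only multiples of `f` survive (`ParamB.value_eq_of_le`).

Membership in the cone is `ParamB.quinticB_nonneg`: with `x + y + z` and `xy + yz + zx` fixed, `f`
is affine in `xyz`, so it suffices to look where two variables agree or one vanishes. There `f` is a
visibly nonnegative product.

For degree ten, split a form `G` with `0 ≤ G ≤ f(x², y², z²)` by parity of exponents. Averaging over
sign changes shows that the even part is a quintic in the squares between `0` and `f`, hence a
multiple of `f`, and that a part such as `x y k(x², y², z²)` is bounded by `f(x², y², z²)` in
absolute value. The same zeros force the quartic `k` to vanish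
(`ParamB.value_eq_zero_of_sqrt_mul_le`). -/

namespace TernaryForm

/-- The value at `(x, y, z)` of the ternary form of degree `d` in which `c i j` is the coefficient of
`x^i y^j z^(d-i-j)`. -/
def value (d : ℕ) (c : ℕ → ℕ → ℝ) (x y z : ℝ) : ℝ :=
  ∑ i ∈ Finset.range (d + 1), ∑ j ∈ Finset.range (d + 1 - i), c i j * x ^ i * y ^ j * z ^ (d - i - j)

/-- The exponent vector `(i, j, k)`. -/
noncomputable def exponent (i j k : ℕ) : Fin 3 →₀ ℕ := Finsupp.equivFunOnFinite.symm ![i, j, k]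

lemma eval_eq_value {d : ℕ} {g : MvPolynomial (Fin 3) ℝ} (hg : g ∈ forms 3 d) (a : Fin 3 → ℝ) :
    eval a g = value d (fun i j => coeff (exponent i j (d - i - j)) g) (a 0) (a 1) (a 2) := by
  rw [eval_eq', value, Finset.sum_sigma']
  symm
  apply Finset.sum_bij_ne_zero (fun p _ _ => exponent p.1 p.2 (d - p.1 - p.2))
  · rintro ⟨i, j⟩ _ h
    rw [mem_support_iff]
    intro h0
    simp [h0] at h
  · rintro ⟨i, j⟩ h1 _ ⟨i', j'⟩ h2 _ h
    have e0 := DFunLike.congr_fun h 0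
    have e1 := DFunLike.congr_fun h 1
    simp [exponent] at e0 e1
    simp [e0, e1]
  · intro m hm hne
    have hdeg : m 0 + m 1 + m 2 = d := by
      have h := (mem_homogeneousSubmodule d g).1 hg (mem_support_iff.1 hm)
      rw [Finsupp.weight_apply, Finsupp.sum_fintype _ _ (by simp)] at h
      simpa [Fin.sum_univ_three] using h
    have hm' : exponent (m 0) (m 1) (d - m 0 - m 1) = m := by
      ext i
      fin_cases i <;> simp [exponent]
      omega
    refine ⟨⟨m 0, m 1⟩, by simp; omega, ?_, hm'⟩
    simp only [hm']
    rw [Fin.prod_univ_three] at hne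
    have : d - m 0 - m 1 = m 2 := by omega
    rw [this]
    simpa [mul_assoc] using hne
  · rintro ⟨i, j⟩ h1 _
    rw [Fin.prod_univ_three]
    simp [exponent, mul_assoc]

end TernaryForm

/-! ### Second-order contact and binary forms with prescribed roots -/

/-- A differentiable function dominated by one which has a zero there vanishes to second order. -/
lemma eq_zero_and_deriv_eq_zero_of_abs_le {A B : ℝ → ℝ} {s A' : ℝ}
    (h : ∀ᶠ r in nhds s, |A r| ≤ B r) (hB0 : B s = 0) (hA : HasDerivAt A A' s)
    (hB : DifferentiableAt ℝ B s) : A s = 0 ∧ A' = 0 := by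
  have h0 : A s = 0 := by
    have := h.self_of_nhds
    rw [hB0] at this
    exact abs_nonpos_iff.1 this
  refine ⟨h0, ?_⟩
  have h1 : IsLocalMin (fun r => B r + A r) s := by
    filter_upwards [h] with r hr
    rw [hB0, h0]
    linarith [neg_abs_le (A r)]
  have h2 : IsLocalMin (fun r => B r - A r) s := by
    filter_upwards [h] with r hr
    rw [hB0, h0]
    linarith [le_abs_self (A r)]
  have e1 := h1.hasDerivAt_eq_zero (hB.hasDerivAt.add hA)
  have e2 := h2.hasDerivAt_eq_zero (hB.hasDerivAt.sub hA)
  linarith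

/-- A quintic with double zeros at `u` and `u⁻¹` is a linear factor times `(s² - (u + u⁻¹) s + 1)²`. -/
lemma quintic_coeff_of_double_roots {u u' v e0 e1 e2 e3 e4 e5 : ℝ} (huu : u * u' = 1)
    (huv : u + u' = v) (hne : u ≠ u')
    (h1 : e0 + e1 * u + e2 * u ^ 2 + e3 * u ^ 3 + e4 * u ^ 4 + e5 * u ^ 5 = 0)
    (h2 : e0 + e1 * u' + e2 * u' ^ 2 + e3 * u' ^ 3 + e4 * u' ^ 4 + e5 * u' ^ 5 = 0)
    (h3 : e1 + 2 * e2 * u + 3 * e3 * u ^ 2 + 4 * e4 * u ^ 3 + 5 * e5 * u ^ 4 = 0)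
    (h4 : e1 + 2 * e2 * u' + 3 * e3 * u' ^ 2 + 4 * e4 * u' ^ 3 + 5 * e5 * u' ^ 4 = 0) :
    e1 = e5 - 2 * v * e0 ∧ e2 = -2 * v * e5 + (2 + v ^ 2) * e0 ∧
      e3 = (2 + v ^ 2) * e5 - 2 * v * e0 ∧ e4 = e0 - 2 * v * e5 := by
  have hu : u ≠ 0 := left_ne_zero_of_mul_eq_one huu
  have hu' : u' ≠ 0 := right_ne_zero_of_mul_eq_one huu
  have hd : u - u' ≠ 0 := sub_ne_zero.2 hne
  -- Subtracting `(e5 s + e0)(s² - v s + 1)²` leaves `s` times the cubic with coefficients `d1, …,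
  -- d4`. It inherits the double zeros at `u ≠ u'`, four conditions that make it zero.
  obtain ⟨d1, hd1⟩ : ∃ d, d = e1 - (e5 - 2 * v * e0) := ⟨_, rfl⟩
  obtain ⟨d2, hd2⟩ : ∃ d, d = e2 - (-2 * v * e5 + (2 + v ^ 2) * e0) := ⟨_, rfl⟩
  obtain ⟨d3, hd3⟩ : ∃ d, d = e3 - ((2 + v ^ 2) * e5 - 2 * v * e0) := ⟨_, rfl⟩
  obtain ⟨d4, hd4⟩ : ∃ d, d = e4 - (e0 - 2 * v * e5) := ⟨_, rfl⟩
  have q1 : u ^ 2 - v * u + 1 = 0 := by rw [← huv]; linear_combination -huu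
  have q2 : u' ^ 2 - v * u' + 1 = 0 := by rw [← huv]; linear_combination -huu
  have a1 : d1 + d2 * u + d3 * u ^ 2 + d4 * u ^ 3 = 0 := by
    apply (mul_eq_zero.1 (_ : u * _ = 0)).resolve_left hu
    rw [hd1, hd2, hd3, hd4]
    linear_combination h1 - (e5 * u + e0) * (u ^ 2 - v * u + 1) * q1
  have a2 : d1 + d2 * u' + d3 * u' ^ 2 + d4 * u' ^ 3 = 0 := by
    apply (mul_eq_zero.1 (_ : u' * _ = 0)).resolve_left hu'
    rw [hd1, hd2, hd3, hd4]
    linear_combination h2 - (e5 * u' + e0) * (u' ^ 2 - v * u' + 1) * q2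
  have a3 : d2 + 2 * d3 * u + 3 * d4 * u ^ 2 = 0 := by
    apply (mul_eq_zero.1 (_ : u * _ = 0)).resolve_left hu
    have : d1 + 2 * d2 * u + 3 * d3 * u ^ 2 + 4 * d4 * u ^ 3 = 0 := by
      rw [hd1, hd2, hd3, hd4]
      linear_combination h3 - (e5 * (u ^ 2 - v * u + 1) + (e5 * u + e0) * 2 * (2 * u - v)) * q1
    linear_combination this - a1
  have a4 : d2 + 2 * d3 * u' + 3 * d4 * u' ^ 2 = 0 := by
    apply (mul_eq_zero.1 (_ : u' * _ = 0)).resolve_left hu'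
    have : d1 + 2 * d2 * u' + 3 * d3 * u' ^ 2 + 4 * d4 * u' ^ 3 = 0 := by
      rw [hd1, hd2, hd3, hd4]
      linear_combination h4 - (e5 * (u' ^ 2 - v * u' + 1) + (e5 * u' + e0) * 2 * (2 * u' - v)) * q2
    linear_combination this - a2
  have b4 : d4 = 0 := by
    apply (mul_eq_zero.1 (_ : (u - u') ^ 3 * _ = 0)).resolve_left (pow_ne_zero 3 hd)
    linear_combination (u - u') * (a3 + a4) - 2 * (a1 - a2)
  have b3 : d3 = 0 := by
    apply (mul_eq_zero.1 (_ : (u - u') * _ = 0)).resolve_left hd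
    linear_combination (a3 - a4) / 2 - 3 / 2 * (u ^ 2 - u' ^ 2) * b4
  have b2 : d2 = 0 := by linear_combination a3 - 2 * u * b3 - 3 * u ^ 2 * b4
  have b1 : d1 = 0 := by linear_combination a1 - u * b2 - u ^ 2 * b3 - u ^ 3 * b4
  refine ⟨?_, ?_, ?_, ?_⟩ <;> linarith

/-- The coefficients of a quartic with roots `u` and `u⁻¹`. -/
lemma quartic_coeff_of_roots {u u' v e0 e1 e2 e3 e4 : ℝ} (huu : u * u' = 1)
    (huv : u + u' = v) (hne : u ≠ u')
    (h1 : e0 + e1 * u + e2 * u ^ 2 + e3 * u ^ 3 + e4 * u ^ 4 = 0)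
    (h2 : e0 + e1 * u' + e2 * u' ^ 2 + e3 * u' ^ 3 + e4 * u' ^ 4 = 0) :
    e2 = e0 - v * (e1 + v * e0) + e4 ∧ e3 = e1 + v * e0 - v * e4 := by
  have hu : u ≠ 0 := left_ne_zero_of_mul_eq_one huu
  have hu' : u' ≠ 0 := right_ne_zero_of_mul_eq_one huu
  have hd : u - u' ≠ 0 := sub_ne_zero.2 hne
  have q1 : u ^ 2 - v * u + 1 = 0 := by rw [← huv]; linear_combination -huu
  have q2 : u' ^ 2 - v * u' + 1 = 0 := by rw [← huv]; linear_combination -huu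
  -- Subtracting `(e0 + (e1 + v e0) s + e4 s²)(s² - v s + 1)` leaves `s² (d2 + d3 s)`.
  obtain ⟨d2, hd2⟩ : ∃ d, d = e2 - (e0 - v * (e1 + v * e0) + e4) := ⟨_, rfl⟩
  obtain ⟨d3, hd3⟩ : ∃ d, d = e3 - (e1 + v * e0 - v * e4) := ⟨_, rfl⟩
  have a1 : d2 + d3 * u = 0 := by
    apply (mul_eq_zero.1 (_ : u ^ 2 * _ = 0)).resolve_left (pow_ne_zero 2 hu)
    rw [hd2, hd3]
    linear_combination h1 - (e0 + (e1 + v * e0) * u + e4 * u ^ 2) * q1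
  have a2 : d2 + d3 * u' = 0 := by
    apply (mul_eq_zero.1 (_ : u' ^ 2 * _ = 0)).resolve_left (pow_ne_zero 2 hu')
    rw [hd2, hd3]
    linear_combination h2 - (e0 + (e1 + v * e0) * u' + e4 * u' ^ 2) * q2
  have b3 : d3 = 0 := by
    apply (mul_eq_zero.1 (_ : (u - u') * _ = 0)).resolve_left hd
    linear_combination a1 - a2
  have b2 : d2 = 0 := by linear_combination a1 - u * b3
  constructor <;> linarith

/-! ### The symmetric quintic and its parameters -/

/-- The value at `(x, y, z)` of the symmetric quintic with coefficients
`1, -2w-3, w²+2w+2, p, q` in the basis `s0, …, s4`. -/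
def quinticB (w p q x y z : ℝ) : ℝ :=
  (x ^ 5 + y ^ 5 + z ^ 5 - x * y * z * (x * y + y * z + z * x))
    + (-2 * w - 3) * (x ^ 4 * y + y ^ 4 * z + z ^ 4 * x + (x * y ^ 4 + y * z ^ 4 + z * x ^ 4)
      - 2 * (x * y * z * (x * y + y * z + z * x)))
    + (w ^ 2 + 2 * w + 2) * (x ^ 3 * y ^ 2 + y ^ 3 * z ^ 2 + z ^ 3 * x ^ 2
      + (x ^ 2 * y ^ 3 + y ^ 2 * z ^ 3 + z ^ 2 * x ^ 3)
      - 2 * (x * y * z * (x * y + y * z + z * x)))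
    + p * (x * y * z * (x ^ 2 + y ^ 2 + z ^ 2) - x * y * z * (x * y + y * z + z * x))
    + q * (x * y * z * (x * y + y * z + z * x))

lemma eval_eB (t u : ℝ) (a : Fin 3 → ℝ) :
    eval a (eB t u) =
      quinticB (omega u) (p3B t (omega u)) (p4B t (omega u)) (a 0) (a 1) (a 2) := by
  simp only [eB, s0, s1, s2, s3, s4, cycS, symT, prodU, p1B, p2B, quinticB, map_add, map_sub,
    map_mul, map_pow, eval_X, smul_eval, map_ofNat]
  ring

lemma eval_squareVars (f : MvPolynomial (Fin 3) ℝ) (a : Fin 3 → ℝ) :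
    eval a (squareVars f) = eval (fun i => a i ^ 2) f := by
  have h : (eval a).comp ((aeval (fun i : Fin 3 => (X i ^ 2 : MvPolynomial (Fin 3) ℝ))).toRingHom)
      = eval (fun i => a i ^ 2) := by
    apply MvPolynomial.ringHom_ext <;> simp
  exact congrArg (fun φ => φ f) h

lemma eB_mem_forms (t u : ℝ) : eB t u ∈ forms 3 5 := by
  have hX (i : Fin 3) (n : ℕ) : (X i ^ n : MvPolynomial (Fin 3) ℝ).IsHomogeneous n := by
    simpa using (isHomogeneous_X ℝ i).pow n
  have hc (m n : ℕ) : (cycS m n).IsHomogeneous (m + n) :=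
    (((hX 0 m).mul (hX 1 n)).add ((hX 1 m).mul (hX 2 n))).add ((hX 2 m).mul (hX 0 n))
  have hu : prodU.IsHomogeneous 3 :=
    ((isHomogeneous_X ℝ 0).mul (isHomogeneous_X ℝ 1)).mul (isHomogeneous_X ℝ 2)
  have h11 : prodU * cycS 1 1 ∈ forms 3 5 := hu.mul (hc 1 1)
  have h11' : 2 * (prodU * cycS 1 1) ∈ forms 3 5 := by
    rw [two_mul]; exact add_mem h11 h11
  refine add_mem (add_mem (add_mem (add_mem ?_ ?_) ?_) ?_) ?_
  · exact sub_mem (hc 5 0) h11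
  · exact Submodule.smul_mem _ _ (sub_mem (add_mem (hc 4 1) (hc 1 4)) h11')
  · exact Submodule.smul_mem _ _ (sub_mem (add_mem (hc 3 2) (hc 2 3)) h11')
  · exact Submodule.smul_mem _ _ (sub_mem (hu.mul (hc 2 0)) h11)
  · exact Submodule.smul_mem _ _ h11

lemma squareVars_mem_forms {f : MvPolynomial (Fin 3) ℝ} {d : ℕ} (hf : f ∈ forms 3 d) :
    squareVars f ∈ forms 3 (2 * d) := by
  have h := MvPolynomial.IsHomogeneous.aeval ((mem_homogeneousSubmodule d f).1 hf)
    (fun i : Fin 3 => (X i ^ 2 : MvPolynomial (Fin 3) ℝ)) (n := 2)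
    (fun i => by simpa using (isHomogeneous_X ℝ i).pow 2)
  exact h

/-- The conditions on `t`, `w = ω(u)`, and the coefficients `p = p_3^B`, `q = p_4^B`
that enter the proof. -/
structure ParamB (t u w p q : ℝ) : Prop where
  ht : 2 < t
  hu : 0 < u
  hu1 : u < 1
  hw : u + u⁻¹ = w + 2
  hw0 : 0 < w
  hD : 0 ≤ t ^ 2 * (t - 2) - 2 * t ^ 2 * w - w ^ 2
  hp : t ^ 2 * (t + 2) * p = -(2 * t ^ 3 + 4 * t ^ 2 + 5 * t + 1) * w ^ 2
    + 2 * t ^ 2 * (4 * t ^ 2 + 5 * t + 3) * w - t ^ 2 * (3 * t ^ 3 - 7 * t ^ 2 - 12 * t - 8)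
  hq : t ^ 2 * (t + 2) * q = (t - 1) ^ 3 * (-w ^ 2 - 2 * t ^ 2 * w + t ^ 2 * (t - 2))

/-- `muB t` is the smaller root of `s² - muR t * s + 1`, and `u < 1` lies below the larger one, so
`u + u⁻¹ ≤ muR t`. This reads `w + t² ≤ t √((t-1)(t+2))`, and squaring gives the inequality `hD`. -/
lemma paramB_of_muB_le {t u : ℝ} (ht : 2 ≤ t) (hu : muB t ≤ u) (hu1 : u < 1) :
    ParamB t u (omega u) (p3B t (omega u)) (p4B t (omega u)) := by
  obtain ⟨S, hS⟩ : ∃ S, S = Real.sqrt ((t - 1) * (t + 2)) := ⟨_, rfl⟩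
  have hSS : S ^ 2 = (t - 1) * (t + 2) := by
    rw [hS]; exact Real.sq_sqrt (by nlinarith)
  have hS0 : 0 ≤ S := hS ▸ Real.sqrt_nonneg _
  have hSt : t ≤ S := abs_le_of_sq_le_sq' (by nlinarith) hS0 |>.2
  obtain ⟨m, hm⟩ : ∃ m, m = muR t := ⟨_, rfl⟩
  have hmS : m = 2 - t ^ 2 + t * S := by rw [hm, muR, hS]
  have hm2 : 2 ≤ m := by nlinarith
  obtain ⟨R, hR⟩ : ∃ R, R = Real.sqrt (m ^ 2 - 4) := ⟨_, rfl⟩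
  have hRR : R ^ 2 = m ^ 2 - 4 := by
    rw [hR]; exact Real.sq_sqrt (by nlinarith)
  have hR0 : 0 ≤ R := hR ▸ Real.sqrt_nonneg _
  have hmu : muB t = (1 / 2) * (m - R) := by rw [muB, hR, hm]
  rw [hmu] at hu
  have hRm : R < m := abs_lt_of_sq_lt_sq' (by nlinarith) (by linarith) |>.2
  have hu0 : 0 < u := by linarith
  have hquad : u ^ 2 - m * u + 1 ≤ 0 := by
    have h1 : 0 ≤ u - (1 / 2) * (m - R) := by linarith
    have h2 : u - (1 / 2) * (m + R) ≤ 0 := by linarith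
    nlinarith [mul_nonneg_of_nonpos_of_nonpos (neg_nonpos.2 h1) h2]
  have hinv : u * u⁻¹ = 1 := mul_inv_cancel₀ hu0.ne'
  have hw : u + u⁻¹ = omega u + 2 := by rw [omega]; ring
  obtain ⟨w, hww⟩ : ∃ w, w = omega u := ⟨_, rfl⟩
  rw [← hww] at hw ⊢
  have huw : u * w = (1 - u) ^ 2 := by
    have : w = u + u⁻¹ - 2 := by linarith
    rw [this]; linear_combination hinv
  have hw0 : 0 < w := by
    by_contra h
    nlinarith [sq_pos_of_pos (sub_pos.2 hu1)]
  have hwm : w ≤ m - 2 := by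
    by_contra h
    push Not at h
    nlinarith [mul_pos hu0 (sub_pos.2 h)]
  have hD : 0 ≤ t ^ 2 * (t - 2) - 2 * t ^ 2 * w - w ^ 2 := by
    have h1 : w + t ^ 2 ≤ t * S := by linarith
    have h2 : (w + t ^ 2) ^ 2 ≤ (t * S) ^ 2 := pow_le_pow_left₀ (by positivity) h1 2
    rw [mul_pow, hSS] at h2
    nlinarith
  -- At `t = 2` the bound `hD` becomes `0 ≤ -8w - w²`, against `w > 0`.
  have ht' : 2 < t := by
    rcases ht.lt_or_eq with h | h
    · exact h
    · subst h; nlinarith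
  have ht0 : t ≠ 0 := by linarith
  have ht2 : t + 2 ≠ 0 := by linarith
  refine ⟨ht', hu0, hu1, hw, hw0, hD, ?_, ?_⟩
  · rw [p3B]; field_simp
  · rw [p4B]; field_simp

namespace ParamB

lemma two_mul_w_lt {t u w p q : ℝ} (h : ParamB t u w p q) : 2 * w < t - 2 := by
  have h1 := h.hD
  have h2 := h.hw0
  have h3 := h.ht
  have h4 : 0 < t ^ 2 := by positivity
  by_contra hc
  nlinarith [mul_nonneg h4.le (sub_nonneg.2 (not_lt.1 hc)), sq_pos_of_pos h2]

end ParamB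

/-! ### Nonnegativity on the orthant -/

namespace ParamB

/-- The expression is affine in `D`. It is a square multiple at `D = 0` and `t²` times the form in
`hend` at `D = t²(t-2)`. -/
lemma quadratic_nonneg {t D x y : ℝ} (ht : 2 < t) (hD : 0 ≤ D) (hD' : D ≤ t ^ 2 * (t - 2))
    (hx : 0 ≤ x) (hy : 0 ≤ y) :
    0 ≤ t ^ 2 * (t + 2) * (x - y) ^ 2 + D * y * (2 * (t + 2) * x + (t - 7) * y) := by
  have hend : 0 ≤ (t + 2) * x ^ 2 + 2 * (t + 2) * (t - 3) * (x * y) + (t - 4) ^ 2 * y ^ 2 := by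
    rcases le_or_gt 3 t with h3 | h3
    · have : 0 ≤ t - 3 := by linarith
      positivity
    · have e : (t + 2) * ((t + 2) * x ^ 2 + 2 * (t + 2) * (t - 3) * (x * y) + (t - 4) ^ 2 * y ^ 2)
          = ((t + 2) * (x + (t - 3) * y)) ^ 2 + (t + 2) * ((t - 2) * (1 + t * (3 - t))) * y ^ 2 := by
        ring
      have : 0 ≤ (t - 2) * (1 + t * (3 - t)) := by
        apply mul_nonneg (by linarith)
        nlinarith
      have h2 : 0 < t + 2 := by linarith
      refine nonneg_of_mul_nonneg_right ?_ h2
      rw [e]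
      positivity
  rcases le_or_gt 0 (2 * (t + 2) * x + (t - 7) * y) with h | h
  · have : 0 < t + 2 := by linarith
    positivity
  · have h1 := mul_le_mul_of_nonneg_left hD' (mul_nonneg hy (neg_nonneg.2 h.le))
    have h2 := mul_nonneg (sq_nonneg t) hend
    nlinarith

/-- The values of `p` and `q` are those that produce a double zero at `x = t y`; the cofactor is
then controlled by `quadratic_nonneg`, with `D` the quantity in `hD`. -/
lemma quinticB_two_eq {t u w p q : ℝ} (h : ParamB t u w p q) (x y : ℝ) :
    t ^ 2 * (t + 2) * quinticB w p q x y y = (x - t * y) ^ 2 *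
      (x * (t ^ 2 * (t + 2) * (x - y) ^ 2
        + (t ^ 2 * (t - 2) - 2 * t ^ 2 * w - w ^ 2) * y * (2 * (t + 2) * x + (t - 7) * y))
      + 2 * (t + 2) * w ^ 2 * (x - y) ^ 2 * y) := by
  unfold quinticB
  linear_combination (x * y * y * (x ^ 2 + y ^ 2 + y ^ 2) - x * y * y * (x * y + y * y + y * x)) * h.hp
    + (x * y * y * (x * y + y * y + y * x)) * h.hq

lemma quinticB_two_nonneg {t u w p q x y : ℝ} (h : ParamB t u w p q) (hx : 0 ≤ x) (hy : 0 ≤ y) :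
    0 ≤ quinticB w p q x y y := by
  have ht := h.ht
  have hM : 0 < t ^ 2 * (t + 2) := by
    have : 0 < t := by linarith
    positivity
  refine nonneg_of_mul_nonneg_right ?_ hM
  rw [h.quinticB_two_eq]
  have h1 := quadratic_nonneg ht h.hD (by
    nlinarith [h.hw0, sq_nonneg w, mul_nonneg (sq_nonneg t) h.hw0.le]) hx hy
  have h2 : 0 < t + 2 := by linarith
  positivity

end ParamB

/-- For fixed elementary symmetric functions of degrees one and two, `quinticB` is affine in `xyz`. -/
lemma quinticB_eq (w p q x y z : ℝ) :
    quinticB w p q x y z =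
      (x + y + z) * ((x + y + z) ^ 2 - (w + 4) * (x * y + y * z + z * x)) ^ 2 +
      x * y * z * ((5 - (-2 * w - 3) - 2 * (w ^ 2 + 2 * w + 2) + p) * (x + y + z) ^ 2 +
        (-6 + 3 * (-2 * w - 3) - 3 * (w ^ 2 + 2 * w + 2) - 3 * p + q) * (x * y + y * z + z * x)) := by
  unfold quinticB
  ring

/-- An affine function on an interval is nonnegative if it is so at the ends. -/
lemma affine_nonneg {A B r r0 r1 : ℝ} (h0 : r0 ≤ r) (h1 : r ≤ r1) (hA0 : 0 ≤ A + r0 * B)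
    (hA1 : 0 ≤ A + r1 * B) : 0 ≤ A + r * B := by
  rcases le_total 0 B with h | h <;> nlinarith

/-- For given `P = x + y + z` and `Q = xy + yz + zx`, the product `r = xyz` runs between its values
at the triples with two equal entries, cut off at `0`. Affineness in `r` reduces the claim to these
ends. -/
lemma ParamB.quinticB_nonneg {t u w p q x y z : ℝ} (h : ParamB t u w p q) (hx : 0 ≤ x) (hy : 0 ≤ y)
    (hz : 0 ≤ z) : 0 ≤ quinticB w p q x y z := by
  obtain ⟨P, hP⟩ : ∃ P, P = x + y + z := ⟨_, rfl⟩
  obtain ⟨Q, hQ⟩ : ∃ Q, Q = x * y + y * z + z * x := ⟨_, rfl⟩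
  obtain ⟨r, hr⟩ : ∃ r, r = x * y * z := ⟨_, rfl⟩
  have hP0 : 0 ≤ P := by rw [hP]; positivity
  have hQ0 : 0 ≤ Q := by rw [hQ]; positivity
  have hr0 : 0 ≤ r := by rw [hr]; positivity
  have hPQ : 0 ≤ P ^ 2 - 3 * Q := by
    rw [hP, hQ]; nlinarith [sq_nonneg (x - y), sq_nonneg (y - z), sq_nonneg (z - x)]
  obtain ⟨d, hd⟩ : ∃ d, d = Real.sqrt (P ^ 2 - 3 * Q) := ⟨_, rfl⟩
  have hd0 : 0 ≤ d := hd ▸ Real.sqrt_nonneg _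
  have hdd : d ^ 2 = P ^ 2 - 3 * Q := hd ▸ Real.sq_sqrt hPQ
  have hdP : d ≤ P := abs_le_of_sq_le_sq' (by linarith) hP0 |>.2
  have hQd : Q = (P ^ 2 - d ^ 2) / 3 := by linarith
  -- The triple `((P+2e)/3, (P-e)/3, (P-e)/3)` has the same `P` and `Q`; it lies in the orthant
  -- under `h1` and `h2`.
  have key (e : ℝ) (he : e ^ 2 = d ^ 2) (h1 : 0 ≤ P + 2 * e) (h2 : 0 ≤ P - e) :
      0 ≤ P * (P ^ 2 - (w + 4) * Q) ^ 2 + (P + 2 * e) * (P - e) ^ 2 / 27 *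
        ((5 - (-2 * w - 3) - 2 * (w ^ 2 + 2 * w + 2) + p) * P ^ 2 +
          (-6 + 3 * (-2 * w - 3) - 3 * (w ^ 2 + 2 * w + 2) - 3 * p + q) * Q) := by
    have h3 := h.quinticB_two_nonneg (x := (P + 2 * e) / 3) (y := (P - e) / 3) (by positivity)
      (by positivity)
    rw [quinticB_eq] at h3
    rw [hQd, ← he]
    convert h3 using 1
    ring
  -- The discriminant of the cubic with roots `x, y, z`, factored as a quadratic in `r`.
  have hdisc : 0 ≤ -27 * (r - (P + 2 * d) * (P - d) ^ 2 / 27) *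
      (r - (P + 2 * -d) * (P - -d) ^ 2 / 27) := by
    have e : -27 * (r - (P + 2 * d) * (P - d) ^ 2 / 27) * (r - (P + 2 * -d) * (P - -d) ^ 2 / 27)
        = ((x - y) * (y - z) * (z - x)) ^ 2 := by
      have : -27 * (r - (P + 2 * d) * (P - d) ^ 2 / 27) * (r - (P + 2 * -d) * (P - -d) ^ 2 / 27)
        = -27 * r ^ 2 + 2 * r * (P ^ 3 - 3 * P * d ^ 2)
          - (P ^ 2 - 4 * d ^ 2) * (P ^ 2 - d ^ 2) ^ 2 / 27 := by ring
      rw [this, hdd, hP, hQ, hr]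
      ring
    rw [e]
    positivity
  have hle : (P + 2 * -d) * (P - -d) ^ 2 / 27 ≤ (P + 2 * d) * (P - d) ^ 2 / 27 := by
    nlinarith [pow_nonneg hd0 3]
  have hr1 : r ≤ (P + 2 * d) * (P - d) ^ 2 / 27 := by
    by_contra hc
    push Not at hc
    nlinarith [mul_pos (sub_pos.2 hc) (sub_pos.2 (hle.trans_lt hc))]
  have hr2 : (P + 2 * -d) * (P - -d) ^ 2 / 27 ≤ r := by
    by_contra hc
    push Not at hc
    nlinarith [mul_pos (sub_pos.2 hc) (sub_pos.2 (hc.trans_le hle))]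
  rw [quinticB_eq, ← hP, ← hQ, ← hr]
  have hmax := key d rfl (by linarith) (by linarith)
  -- If `P < 2d`, the triple for `e = -d` leaves the orthant. The lower end is then `r = 0`, where
  -- the form is `P` times a square.
  rcases le_or_gt 0 (P + 2 * -d) with hPd | hPd
  · exact affine_nonneg hr2 hr1 (key (-d) (by ring) hPd (by linarith)) hmax
  · refine affine_nonneg hr0 hr1 ?_ hmax
    rw [zero_mul, add_zero]
    positivity

/-! ### Partial derivatives of ternary forms -/

namespace TernaryForm

/-- The partial derivative in `x` of `value d c`. -/
def derivX (d : ℕ) (c : ℕ → ℕ → ℝ) (x y z : ℝ) : ℝ :=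
  ∑ i ∈ Finset.range (d + 1), ∑ j ∈ Finset.range (d + 1 - i),
    c i j * (i * x ^ (i - 1)) * y ^ j * z ^ (d - i - j)

/-- The partial derivative in `y` of `value d c`. -/
def derivY (d : ℕ) (c : ℕ → ℕ → ℝ) (x y z : ℝ) : ℝ :=
  ∑ i ∈ Finset.range (d + 1), ∑ j ∈ Finset.range (d + 1 - i),
    c i j * x ^ i * (j * y ^ (j - 1)) * z ^ (d - i - j)

/-- The partial derivative in `z` of `value d c`. -/
def derivZ (d : ℕ) (c : ℕ → ℕ → ℝ) (x y z : ℝ) : ℝ :=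
  ∑ i ∈ Finset.range (d + 1), ∑ j ∈ Finset.range (d + 1 - i),
    c i j * x ^ i * y ^ j * ((d - i - j : ℕ) * z ^ (d - i - j - 1))

lemma hasDerivAt_value_x (d : ℕ) (c : ℕ → ℕ → ℝ) (x y z : ℝ) :
    HasDerivAt (fun s => value d c s y z) (derivX d c x y z) x :=
  HasDerivAt.fun_sum fun i _ => HasDerivAt.fun_sum fun _ _ =>
    (((hasDerivAt_pow i x).const_mul _).mul_const _).mul_const _

lemma hasDerivAt_value_y (d : ℕ) (c : ℕ → ℕ → ℝ) (x y z : ℝ) :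
    HasDerivAt (fun s => value d c x s z) (derivY d c x y z) y :=
  HasDerivAt.fun_sum fun _ _ => HasDerivAt.fun_sum fun j _ =>
    ((hasDerivAt_pow j y).const_mul _).mul_const _

lemma hasDerivAt_value_z (d : ℕ) (c : ℕ → ℕ → ℝ) (x y z : ℝ) :
    HasDerivAt (fun s => value d c x y s) (derivZ d c x y z) z :=
  HasDerivAt.fun_sum fun _ _ => HasDerivAt.fun_sum fun _ _ =>
    (hasDerivAt_pow _ z).const_mul _

lemma value_four (c : ℕ → ℕ → ℝ) (x y z : ℝ) : value 4 c x y z =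
    c 4 0 * x ^ 4 + c 3 1 * x ^ 3 * y + c 3 0 * x ^ 3 * z + c 2 2 * x ^ 2 * y ^ 2
      + c 2 1 * x ^ 2 * y * z + c 2 0 * x ^ 2 * z ^ 2 + c 1 3 * x * y ^ 3 + c 1 2 * x * y ^ 2 * z
      + c 1 1 * x * y * z ^ 2 + c 1 0 * x * z ^ 3 + c 0 4 * y ^ 4 + c 0 3 * y ^ 3 * z
      + c 0 2 * y ^ 2 * z ^ 2 + c 0 1 * y * z ^ 3 + c 0 0 * z ^ 4 := by
  simp only [value, Finset.sum_range_succ, Finset.sum_range_zero]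
  norm_num
  ring

lemma derivX_four (c : ℕ → ℕ → ℝ) (x y z : ℝ) : derivX 4 c x y z =
    4 * c 4 0 * x ^ 3 + 3 * c 3 1 * x ^ 2 * y + 3 * c 3 0 * x ^ 2 * z + 2 * c 2 2 * x * y ^ 2
      + 2 * c 2 1 * x * y * z + 2 * c 2 0 * x * z ^ 2 + c 1 3 * y ^ 3 + c 1 2 * y ^ 2 * z
      + c 1 1 * y * z ^ 2 + c 1 0 * z ^ 3 := by
  simp only [derivX, Finset.sum_range_succ, Finset.sum_range_zero]
  norm_num
  ring

lemma derivY_four (c : ℕ → ℕ → ℝ) (x y z : ℝ) : derivY 4 c x y z =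
    c 3 1 * x ^ 3 + 2 * c 2 2 * x ^ 2 * y + c 2 1 * x ^ 2 * z + 3 * c 1 3 * x * y ^ 2
      + 2 * c 1 2 * x * y * z + c 1 1 * x * z ^ 2 + 4 * c 0 4 * y ^ 3 + 3 * c 0 3 * y ^ 2 * z
      + 2 * c 0 2 * y * z ^ 2 + c 0 1 * z ^ 3 := by
  simp only [derivY, Finset.sum_range_succ, Finset.sum_range_zero]
  norm_num
  ring

lemma derivZ_four (c : ℕ → ℕ → ℝ) (x y z : ℝ) : derivZ 4 c x y z =
    c 3 0 * x ^ 3 + c 2 1 * x ^ 2 * y + 2 * c 2 0 * x ^ 2 * z + c 1 2 * x * y ^ 2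
      + 2 * c 1 1 * x * y * z + 3 * c 1 0 * x * z ^ 2 + c 0 3 * y ^ 3 + 2 * c 0 2 * y ^ 2 * z
      + 3 * c 0 1 * y * z ^ 2 + 4 * c 0 0 * z ^ 3 := by
  simp only [derivZ, Finset.sum_range_succ, Finset.sum_range_zero]
  norm_num
  ring

lemma value_five (c : ℕ → ℕ → ℝ) (x y z : ℝ) : value 5 c x y z =
    c 5 0 * x ^ 5 + c 4 1 * x ^ 4 * y + c 4 0 * x ^ 4 * z + c 3 2 * x ^ 3 * y ^ 2
      + c 3 1 * x ^ 3 * y * z + c 3 0 * x ^ 3 * z ^ 2 + c 2 3 * x ^ 2 * y ^ 3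
      + c 2 2 * x ^ 2 * y ^ 2 * z + c 2 1 * x ^ 2 * y * z ^ 2 + c 2 0 * x ^ 2 * z ^ 3
      + c 1 4 * x * y ^ 4 + c 1 3 * x * y ^ 3 * z + c 1 2 * x * y ^ 2 * z ^ 2
      + c 1 1 * x * y * z ^ 3 + c 1 0 * x * z ^ 4 + c 0 5 * y ^ 5 + c 0 4 * y ^ 4 * z
      + c 0 3 * y ^ 3 * z ^ 2 + c 0 2 * y ^ 2 * z ^ 3 + c 0 1 * y * z ^ 4 + c 0 0 * z ^ 5 := by
  simp only [value, Finset.sum_range_succ, Finset.sum_range_zero]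
  norm_num
  ring

lemma derivX_five (c : ℕ → ℕ → ℝ) (x y z : ℝ) : derivX 5 c x y z =
    5 * c 5 0 * x ^ 4 + 4 * c 4 1 * x ^ 3 * y + 4 * c 4 0 * x ^ 3 * z + 3 * c 3 2 * x ^ 2 * y ^ 2
      + 3 * c 3 1 * x ^ 2 * y * z + 3 * c 3 0 * x ^ 2 * z ^ 2 + 2 * c 2 3 * x * y ^ 3
      + 2 * c 2 2 * x * y ^ 2 * z + 2 * c 2 1 * x * y * z ^ 2 + 2 * c 2 0 * x * z ^ 3
      + c 1 4 * y ^ 4 + c 1 3 * y ^ 3 * z + c 1 2 * y ^ 2 * z ^ 2 + c 1 1 * y * z ^ 3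
      + c 1 0 * z ^ 4 := by
  simp only [derivX, Finset.sum_range_succ, Finset.sum_range_zero]
  norm_num
  ring

lemma derivY_five (c : ℕ → ℕ → ℝ) (x y z : ℝ) : derivY 5 c x y z =
    c 4 1 * x ^ 4 + 2 * c 3 2 * x ^ 3 * y + c 3 1 * x ^ 3 * z + 3 * c 2 3 * x ^ 2 * y ^ 2
      + 2 * c 2 2 * x ^ 2 * y * z + c 2 1 * x ^ 2 * z ^ 2 + 4 * c 1 4 * x * y ^ 3
      + 3 * c 1 3 * x * y ^ 2 * z + 2 * c 1 2 * x * y * z ^ 2 + c 1 1 * x * z ^ 3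
      + 5 * c 0 5 * y ^ 4 + 4 * c 0 4 * y ^ 3 * z + 3 * c 0 3 * y ^ 2 * z ^ 2
      + 2 * c 0 2 * y * z ^ 3 + c 0 1 * z ^ 4 := by
  simp only [derivY, Finset.sum_range_succ, Finset.sum_range_zero]
  norm_num
  ring

lemma derivZ_five (c : ℕ → ℕ → ℝ) (x y z : ℝ) : derivZ 5 c x y z =
    c 4 0 * x ^ 4 + c 3 1 * x ^ 3 * y + 2 * c 3 0 * x ^ 3 * z + c 2 2 * x ^ 2 * y ^ 2
      + 2 * c 2 1 * x ^ 2 * y * z + 3 * c 2 0 * x ^ 2 * z ^ 2 + c 1 3 * x * y ^ 3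
      + 2 * c 1 2 * x * y ^ 2 * z + 3 * c 1 1 * x * y * z ^ 2 + 4 * c 1 0 * x * z ^ 3
      + c 0 4 * y ^ 4 + 2 * c 0 3 * y ^ 3 * z + 3 * c 0 2 * y ^ 2 * z ^ 2 + 4 * c 0 1 * y * z ^ 3
      + 5 * c 0 0 * z ^ 4 := by
  simp only [derivZ, Finset.sum_range_succ, Finset.sum_range_zero]
  norm_num
  ring

variable {d : ℕ} {c : ℕ → ℕ → ℝ} {x y z : ℝ} {φ : ℝ → ℝ}

/-- Only the varied coordinate has to be positive, so the lemma also applies along the boundary of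
the orthant. -/
lemma critical_x (hx : 0 < x) (h : ∀ s, 0 < s → |value d c s y z| ≤ φ s) (h0 : φ x = 0)
    (hφ : DifferentiableAt ℝ φ x) : value d c x y z = 0 ∧ derivX d c x y z = 0 :=
  eq_zero_and_deriv_eq_zero_of_abs_le (A := fun s => value d c s y z) ((lt_mem_nhds hx).mono h) h0
    (hasDerivAt_value_x d c x y z) hφ

lemma critical_y (hy : 0 < y) (h : ∀ s, 0 < s → |value d c x s z| ≤ φ s) (h0 : φ y = 0)
    (hφ : DifferentiableAt ℝ φ y) : value d c x y z = 0 ∧ derivY d c x y z = 0 :=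
  eq_zero_and_deriv_eq_zero_of_abs_le (A := fun s => value d c x s z) ((lt_mem_nhds hy).mono h) h0
    (hasDerivAt_value_y d c x y z) hφ

lemma critical_z (hz : 0 < z) (h : ∀ s, 0 < s → |value d c x y s| ≤ φ s) (h0 : φ z = 0)
    (hφ : DifferentiableAt ℝ φ z) : value d c x y z = 0 ∧ derivZ d c x y z = 0 :=
  eq_zero_and_deriv_eq_zero_of_abs_le (A := fun s => value d c x y s) ((lt_mem_nhds hz).mono h) h0
    (hasDerivAt_value_z d c x y z) hφ

end TernaryForm

/-! ### Zeros of the quintic and the linear conditions they impose -/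

lemma quinticB_swap (w p q x y z : ℝ) : quinticB w p q y x z = quinticB w p q x y z := by
  unfold quinticB; ring

lemma quinticB_cycle (w p q x y z : ℝ) : quinticB w p q y z x = quinticB w p q x y z := by
  unfold quinticB; ring

lemma quinticB_swap_right (w p q x y z : ℝ) : quinticB w p q x z y = quinticB w p q x y z := by
  unfold quinticB; ring

lemma quinticB_edge (w p q x y : ℝ) :
    quinticB w p q x y 0 = (x + y) * (x ^ 2 - (w + 2) * x * y + y ^ 2) ^ 2 := by
  unfold quinticB; ring

namespace ParamB

variable {t u w p q : ℝ}

lemma mul_inv (h : ParamB t u w p q) : u * u⁻¹ = 1 := mul_inv_cancel₀ h.hu.ne'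

lemma inv_pos (h : ParamB t u w p q) : 0 < u⁻¹ := _root_.inv_pos.2 h.hu

lemma ne_inv (h : ParamB t u w p q) : u ≠ u⁻¹ :=
  (h.hu1.trans ((one_lt_inv₀ h.hu).2 h.hu1)).ne

lemma quinticB_edge_root (h : ParamB t u w p q) : quinticB w p q 1 u 0 = 0 := by
  rw [quinticB_edge, ← h.hw]
  have : (1 : ℝ) ^ 2 - (u + u⁻¹) * 1 * u + u ^ 2 = 0 := by linear_combination -h.mul_inv
  rw [this]; ring

lemma quinticB_edge_root_inv (h : ParamB t u w p q) : quinticB w p q 1 u⁻¹ 0 = 0 := by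
  rw [quinticB_edge, ← h.hw]
  have : (1 : ℝ) ^ 2 - (u + u⁻¹) * 1 * u⁻¹ + u⁻¹ ^ 2 = 0 := by linear_combination -h.mul_inv
  rw [this]; ring

lemma quinticB_interior_root (h : ParamB t u w p q) : quinticB w p q t 1 1 = 0 := by
  have ht := h.ht
  have hM : t ^ 2 * (t + 2) ≠ 0 := by
    have : 0 < t := by linarith
    positivity
  refine (mul_eq_zero.1 (?_ : t ^ 2 * (t + 2) * _ = 0)).resolve_left hM
  rw [h.quinticB_two_eq]; ring

lemma sub_root_neg (h : ParamB t u w p q) : w - t * (t + 4) < 0 := by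
  nlinarith [h.ht, h.two_mul_w_lt]

/-- The conditions at the interior zeros, for the differences between two variables. -/
lemma eq_zero_of_diff_system (h : ParamB t u w p q) (hb : b1B t w ≠ 0) {X Q R : ℝ}
    (h1 : (t ^ 5 - (4 * w + 9) * t ^ 4 + (2 * w ^ 2 + 10 * w + 16) * t ^ 3
      - (w ^ 2 + 8 * w + 14) * t ^ 2 + (2 * w + 6) * t - w ^ 2) * X
      + t * (t ^ 2 - 1) * Q + t * (1 - t) * R = 0)
    (h2 : (5 * t ^ 4 - (16 * w + 36) * t ^ 3 + (6 * w ^ 2 + 30 * w + 48) * t ^ 2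
      - (2 * w ^ 2 + 16 * w + 28) * t + 2 * w + 6) * X
      + (3 * t ^ 2 - 1) * Q + (1 - 2 * t) * R = 0)
    (h3 : (w ^ 2 + t ^ 4 - (4 * w + 8) * t ^ 3 + (3 * w ^ 2 + 12 * w + 18) * t ^ 2
      - (8 * w + 16) * t) * X + 2 * t * Q - t ^ 2 * R = 0) : X = 0 ∧ Q = 0 ∧ R = 0 := by
  have ht := h.ht
  have ht0 : t ≠ 0 := by linarith
  have ht1 : t - 1 ≠ 0 := by linarith
  have hX : X = 0 := by
    -- The determinant of the system; the multipliers below are the cofactors of the `X` column.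
    have hne : t * (t - 1) ^ 4 * (2 * b1B t w * (w - t * (t + 4))) ≠ 0 :=
      mul_ne_zero (mul_ne_zero ht0 (pow_ne_zero 4 ht1))
        (mul_ne_zero (mul_ne_zero two_ne_zero hb) h.sub_root_neg.ne)
    refine (mul_eq_zero.1 (?_ : _ * X = 0)).resolve_left hne
    unfold b1B
    linear_combination ((3 * t ^ 2 - 1) * (-t ^ 2) - (1 - 2 * t) * (2 * t)) * h1
      - (t * (t ^ 2 - 1) * (-t ^ 2) - t * (1 - t) * (2 * t)) * h2
      + (t * (t ^ 2 - 1) * (1 - 2 * t) - t * (1 - t) * (3 * t ^ 2 - 1)) * h3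
  subst hX
  have hne : t ^ 2 * (t - 1) ^ 2 ≠ 0 := mul_ne_zero (pow_ne_zero 2 ht0) (pow_ne_zero 2 ht1)
  refine ⟨rfl, ?_, ?_⟩
  · refine (mul_eq_zero.1 (?_ : _ * Q = 0)).resolve_left hne
    linear_combination (1 - 2 * t) * h1 - t * (1 - t) * h2
  · refine (mul_eq_zero.1 (?_ : _ * R = 0)).resolve_left hne
    linear_combination t * (t ^ 2 - 1) * h2 - (3 * t ^ 2 - 1) * h1

/-- The conditions at an interior zero, for symmetric forms. -/
lemma eq_of_sym_system (h : ParamB t u w p q) {X Q R : ℝ}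
    (h1 : (2 * w ^ 2 + t ^ 5 - (4 * w + 6) * t ^ 4 + (2 * w ^ 2 + 4 * w + 4) * t ^ 3
      + (2 * w ^ 2 + 4 * w + 4) * t ^ 2 - (4 * w + 6) * t) * X
      + t * (t ^ 2 + 2) * Q + t * (1 + 2 * t) * R = 0)
    (h2 : (5 * t ^ 4 - (16 * w + 24) * t ^ 3 + (6 * w ^ 2 + 12 * w + 12) * t ^ 2
      + (4 * w ^ 2 + 8 * w + 8) * t - 4 * w - 6) * X
      + (3 * t ^ 2 + 2) * Q + (1 + 4 * t) * R = 0) :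
    Q = X * p ∧ R = X * (-1 - 2 * (-2 * w - 3) - 2 * (w ^ 2 + 2 * w + 2) - p + q) := by
  have ht := h.ht
  have ht0 : t ≠ 0 := by linarith
  have hM : t ^ 2 * (t + 2) ≠ 0 := mul_ne_zero (pow_ne_zero 2 ht0) (by linarith)
  have hne : 2 * t ^ 2 * ((t - 1) * (t + 2)) ≠ 0 :=
    mul_ne_zero (mul_ne_zero two_ne_zero (pow_ne_zero 2 ht0))
      (mul_ne_zero (by linarith) (by linarith))
  obtain ⟨ρ, hρ⟩ : ∃ ρ, ρ = -1 - 2 * (-2 * w - 3) - 2 * (w ^ 2 + 2 * w + 2) - p + q := ⟨_, rfl⟩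
  -- `quinticB` itself solves the system with `X = 1`, `Q = p`, `R = ρ`. Subtracting `X` times this
  -- solution leaves a homogeneous 2×2 system with nonzero determinant.
  have f1 : (2 * w ^ 2 + t ^ 5 - (4 * w + 6) * t ^ 4 + (2 * w ^ 2 + 4 * w + 4) * t ^ 3
      + (2 * w ^ 2 + 4 * w + 4) * t ^ 2 - (4 * w + 6) * t)
      + t * (t ^ 2 + 2) * p + t * (1 + 2 * t) * ρ = 0 := by
    refine (mul_eq_zero.1 (?_ : t ^ 2 * (t + 2) * _ = 0)).resolve_left hM
    rw [hρ]
    linear_combination (t * (t ^ 2 + 2) - t * (1 + 2 * t)) * h.hp + t * (1 + 2 * t) * h.hq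
  have f2 : (5 * t ^ 4 - (16 * w + 24) * t ^ 3 + (6 * w ^ 2 + 12 * w + 12) * t ^ 2
      + (4 * w ^ 2 + 8 * w + 8) * t - 4 * w - 6)
      + (3 * t ^ 2 + 2) * p + (1 + 4 * t) * ρ = 0 := by
    refine (mul_eq_zero.1 (?_ : t ^ 2 * (t + 2) * _ = 0)).resolve_left hM
    rw [hρ]
    linear_combination ((3 * t ^ 2 + 2) - (1 + 4 * t)) * h.hp + (1 + 4 * t) * h.hq
  rw [← hρ]
  constructor
  · refine sub_eq_zero.1 ((mul_eq_zero.1 (?_ : _ * (Q - X * p) = 0)).resolve_left hne)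
    linear_combination -(1 + 4 * t) * (h1 - X * f1) + t * (1 + 2 * t) * (h2 - X * f2)
  · refine sub_eq_zero.1 ((mul_eq_zero.1 (?_ : _ * (R - X * ρ) = 0)).resolve_left hne)
    linear_combination (3 * t ^ 2 + 2) * (h1 - X * f1) - t * (t ^ 2 + 2) * (h2 - X * f2)

end ParamB

/-! ### Dominated quintics -/

open TernaryForm

/-- A quintic form between `0` and `quinticB` on the orthant is a multiple of `quinticB`. -/
theorem ParamB.value_eq_of_le {t u w p q : ℝ} (h : ParamB t u w p q) (hb : b1B t w ≠ 0)
    {c : ℕ → ℕ → ℝ} (hc : ∀ x y z, 0 ≤ x → 0 ≤ y → 0 ≤ z →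
      0 ≤ value 5 c x y z ∧ value 5 c x y z ≤ quinticB w p q x y z) (x y z : ℝ) :
    value 5 c x y z = c 5 0 * quinticB w p q x y z := by
  have habs (x y z : ℝ) (hx : 0 ≤ x) (hy : 0 ≤ y) (hz : 0 ≤ z) :
      |value 5 c x y z| ≤ quinticB w p q x y z := by
    rw [abs_of_nonneg (hc x y z hx hy hz).1]
    exact (hc x y z hx hy hz).2
  have cx {x y z : ℝ} (hx : 0 < x) (hy : 0 ≤ y) (hz : 0 ≤ z) (h0 : quinticB w p q x y z = 0) :
      value 5 c x y z = 0 ∧ derivX 5 c x y z = 0 :=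
    critical_x hx (fun s hs => habs s y z hs.le hy hz) h0 (by unfold quinticB; fun_prop)
  have cy {x y z : ℝ} (hx : 0 ≤ x) (hy : 0 < y) (hz : 0 ≤ z) (h0 : quinticB w p q x y z = 0) :
      value 5 c x y z = 0 ∧ derivY 5 c x y z = 0 :=
    critical_y hy (fun s hs => habs x s z hx hs.le hz) h0 (by unfold quinticB; fun_prop)
  have cz {x y z : ℝ} (hx : 0 ≤ x) (hy : 0 ≤ y) (hz : 0 < z) (h0 : quinticB w p q x y z = 0) :
      value 5 c x y z = 0 ∧ derivZ 5 c x y z = 0 :=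
    critical_z hz (fun s hs => habs x y s hx hy hs.le) h0 (by unfold quinticB; fun_prop)
  have hu := h.hu
  have hu' := h.inv_pos
  have z1 := h.quinticB_edge_root
  have z2 := h.quinticB_edge_root_inv
  obtain ⟨e41, e32, e23, e14⟩ : c 4 1 = c 0 5 - 2 * (w + 2) * c 5 0 ∧
      c 3 2 = -2 * (w + 2) * c 0 5 + (2 + (w + 2) ^ 2) * c 5 0 ∧
      c 2 3 = (2 + (w + 2) ^ 2) * c 0 5 - 2 * (w + 2) * c 5 0 ∧
      c 1 4 = c 5 0 - 2 * (w + 2) * c 0 5 := by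
    have h1 := cy zero_le_one hu le_rfl z1
    have h2 := cy zero_le_one hu' le_rfl z2
    rw [value_five, derivY_five] at h1 h2
    exact quintic_coeff_of_double_roots h.mul_inv h.hw h.ne_inv (by linear_combination h1.1)
      (by linear_combination h2.1) (by linear_combination h1.2) (by linear_combination h2.2)
  obtain ⟨e40, e30, e20, e10⟩ : c 4 0 = c 0 0 - 2 * (w + 2) * c 5 0 ∧
      c 3 0 = -2 * (w + 2) * c 0 0 + (2 + (w + 2) ^ 2) * c 5 0 ∧
      c 2 0 = (2 + (w + 2) ^ 2) * c 0 0 - 2 * (w + 2) * c 5 0 ∧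
      c 1 0 = c 5 0 - 2 * (w + 2) * c 0 0 := by
    have h1 := cz zero_le_one le_rfl hu ((quinticB_swap_right ..).trans z1)
    have h2 := cz zero_le_one le_rfl hu' ((quinticB_swap_right ..).trans z2)
    rw [value_five, derivZ_five] at h1 h2
    exact quintic_coeff_of_double_roots h.mul_inv h.hw h.ne_inv (by linear_combination h1.1)
      (by linear_combination h2.1) (by linear_combination h1.2) (by linear_combination h2.2)
  obtain ⟨e04, e03, e02, e01⟩ : c 0 4 = c 0 0 - 2 * (w + 2) * c 0 5 ∧
      c 0 3 = -2 * (w + 2) * c 0 0 + (2 + (w + 2) ^ 2) * c 0 5 ∧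
      c 0 2 = (2 + (w + 2) ^ 2) * c 0 0 - 2 * (w + 2) * c 0 5 ∧
      c 0 1 = c 0 5 - 2 * (w + 2) * c 0 0 := by
    have h1 := cz le_rfl zero_le_one hu ((quinticB_cycle w p q 0 1 u).symm.trans z1)
    have h2 := cz le_rfl zero_le_one hu' ((quinticB_cycle w p q 0 1 u⁻¹).symm.trans z2)
    rw [value_five, derivZ_five] at h1 h2
    exact quintic_coeff_of_double_roots h.mul_inv h.hw h.ne_inv (by linear_combination h1.1)
      (by linear_combination h2.1) (by linear_combination h1.2) (by linear_combination h2.2)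
  have ht : 0 < t := by linarith [h.ht]
  have t1 := h.quinticB_interior_root
  have t2 : quinticB w p q 1 t 1 = 0 := by rw [quinticB_swap, t1]
  have t3 : quinticB w p q 1 1 t = 0 := by rw [quinticB_cycle, t1]
  obtain ⟨V1, X1⟩ := cx ht zero_le_one zero_le_one t1
  obtain ⟨-, Y1⟩ := cy ht.le one_pos zero_le_one t1
  obtain ⟨-, Z1⟩ := cz ht.le zero_le_one one_pos t1
  obtain ⟨V2, Y2⟩ := cy zero_le_one ht zero_le_one t2
  obtain ⟨V3, Z3⟩ := cz zero_le_one zero_le_one ht t3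
  obtain ⟨-, X3⟩ := cx one_pos zero_le_one ht.le t3
  obtain ⟨-, Y3⟩ := cy zero_le_one one_pos ht.le t3
  rw [value_five] at V1 V2 V3
  rw [derivX_five] at X1 X3
  rw [derivY_five] at Y1 Y2 Y3
  rw [derivZ_five] at Z1 Z3
  rw [value_five]
  simp only [e41, e32, e23, e14, e40, e30, e20, e10, e04, e03, e02, e01] at *
  -- Of the 21 coefficients, three at the vertices and six divisible by `xyz` remain. Comparing
  -- conditions at zeros exchanged by a transposition isolates the antisymmetric differences.
  obtain ⟨hX, hQ, hR⟩ := h.eq_zero_of_diff_system hb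
    (X := c 5 0 - c 0 5) (Q := c 3 1 - c 1 3) (R := c 1 2 - c 2 1)
    (by linear_combination V1 - V2) (by linear_combination X1 - Y2) (by linear_combination X3 - Y3)
  obtain ⟨hY, hQ', hR'⟩ := h.eq_zero_of_diff_system hb
    (X := c 0 5 - c 0 0) (Q := c 1 3 - c 1 1) (R := c 2 1 - c 2 2)
    (by linear_combination V2 - V3) (by linear_combination Y2 - Z3) (by linear_combination Y1 - Z1)
  have i1 : c 0 5 = c 5 0 := by linarith
  have i2 : c 0 0 = c 5 0 := by linarith
  have i3 : c 1 3 = c 3 1 := by linarith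
  have i4 : c 1 1 = c 3 1 := by linarith
  have i5 : c 2 1 = c 1 2 := by linarith
  have i6 : c 2 2 = c 1 2 := by linarith
  simp only [i1, i2, i3, i4, i5, i6] at *
  obtain ⟨j1, j2⟩ := h.eq_of_sym_system (X := c 5 0) (Q := c 3 1) (R := c 1 2)
    (by linear_combination V1) (by linear_combination X1)
  rw [j1, j2]
  unfold quinticB
  ring

/-! ### Dominated quartics -/

namespace ParamB

variable {t u w p q : ℝ}

/-- Kills the part of the quartic that is antisymmetric in `x, y`. The determinant needs only `w < t
- 2`, not `b1B ≠ 0`. -/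
lemma eq_zero_of_quartic_antisym_system (h : ParamB t u w p q) {M A : ℝ}
    (h1 : (-w - t ^ 3 + t ^ 2 * w + 2 * t ^ 2 - t) * M + t * (t - 1) * A = 0)
    (h2 : -2 * w * M + t * (t - 2) * A = 0) : M = 0 ∧ A = 0 := by
  have ht := h.ht
  have hw := h.two_mul_w_lt
  have hw0 := h.hw0
  have hM : M = 0 := by
    have hne : t * (t - 1) ^ 2 * (t - 2 - w) ≠ 0 :=
      mul_ne_zero (mul_ne_zero (by linarith) (pow_ne_zero 2 (by linarith))) (by linarith)
    refine (mul_eq_zero.1 (?_ : _ * M = 0)).resolve_left hne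
    linear_combination -(t - 2) * h1 + (t - 1) * h2
  subst hM
  have hne : t * (t - 2) ≠ 0 := mul_ne_zero (by linarith) (by linarith)
  exact ⟨rfl, (mul_eq_zero.1 (by linear_combination h2)).resolve_left hne⟩

lemma eq_zero_of_quartic_sym_system (h : ParamB t u w p q) (hb : b1B t w ≠ 0) {L N M A C : ℝ}
    (h1 : (w ^ 2 + 2 * t ^ 2 - 2 * t * w - 4 * t) * L
      + (t ^ 4 - 2 * t ^ 3 * w - 4 * t ^ 3 + 2 * t ^ 2) * N
      + (2 * t ^ 3 - 2 * t ^ 2 * w - 4 * t ^ 2 + 2 * t) * M + 2 * t * A + t ^ 2 * C = 0)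
    (h2 : (2 * w ^ 2 + 2 * t ^ 2 - 3 * t * w - 6 * t) * L
      + (-t ^ 3 * w - 2 * t ^ 3 + 2 * t ^ 2) * N
      + (t ^ 3 - 2 * t ^ 2 * w - 4 * t ^ 2 + 3 * t) * M + 3 * t * A + t ^ 2 * C = 0)
    (h3 : (-w + t ^ 4 - 3 * t ^ 3 * w - 6 * t ^ 3 + t ^ 2 * w ^ 2 + 4 * t ^ 2 * w + 7 * t ^ 2
      - 2 * t * w - 4 * t) * L + (-w + t ^ 2 - t * w - 2 * t) * N
      + (-w + t ^ 3 - t ^ 2 * w - 2 * t ^ 2 + t) * M + (t ^ 2 + t) * A + t * C = 0)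
    (h4 : (-3 * w - 2 * t ^ 3 * w - 4 * t ^ 3 + 2 * t ^ 2 * w ^ 2 + 8 * t ^ 2 * w + 12 * t ^ 2
      - 6 * t * w - 12 * t) * L - w * N - 2 * w * M + (t ^ 2 + 2 * t) * A + t * C = 0)
    (h5 : (-w - t ^ 3 * w - 2 * t ^ 3 + 2 * t ^ 2) * L
      + (-3 * w + 2 * t ^ 2 - 3 * t * w - 6 * t) * N
      + (-2 * w + t ^ 3 - 2 * t ^ 2 * w - 4 * t ^ 2 + 3 * t) * M + (t ^ 2 + t) * A
      + 2 * t * C = 0) :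
    L = 0 ∧ N = 0 ∧ M = 0 ∧ A = 0 ∧ C = 0 := by
  have ht := h.ht
  have hw := h.two_mul_w_lt
  have hw0 := h.hw0
  have ht0 : t ≠ 0 := by linarith
  have ht1 : t - 1 ≠ 0 := by linarith
  have hneg : (t + 1) * w - t ^ 2 < 0 := by nlinarith
  obtain ⟨L1, hL1⟩ : ∃ l, l = w ^ 2 + 4 * w - t ^ 4 + t ^ 3 * w - 2 * t ^ 3 + t ^ 2 * w ^ 2
    + 10 * t ^ 2 * w + 12 * t ^ 2 + 2 * t * w ^ 2 + 13 * t * w + 12 * t := ⟨_, rfl⟩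
  obtain ⟨L2, hL2⟩ : ∃ l, l = -2 * w ^ 2 - 6 * w - t ^ 5 + t ^ 4 * w - t ^ 4 + t ^ 3 * w ^ 2
    + 9 * t ^ 3 * w + 15 * t ^ 3 + t ^ 2 * w ^ 2 + 2 * t ^ 2 * w - t ^ 2 - 2 * t * w ^ 2
    - 14 * t * w - 18 * t := ⟨_, rfl⟩
  obtain ⟨L3, hL3⟩ : ∃ l, l = w - t ^ 4 + t ^ 3 * w - 2 * t ^ 3 + t ^ 2 * w ^ 2 + 11 * t ^ 2 * w
    + 15 * t ^ 2 + 3 * t * w := ⟨_, rfl⟩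
  obtain ⟨M1, hM1⟩ : ∃ l, l = 2 * w - t ^ 3 + t ^ 2 * w - 2 * t ^ 2 + 4 * t * w + 4 * t :=
    ⟨_, rfl⟩
  obtain ⟨M2, hM2⟩ : ∃ l, l = -3 * w - t ^ 4 + t ^ 3 * w - t ^ 3 + 3 * t ^ 2 * w + 6 * t ^ 2
    - 3 * t * w - 6 * t := ⟨_, rfl⟩
  -- `h4` eliminates `C` and `h3 - h4`, which is free of `C`, eliminates `A`; powers of `t - 1` then
  -- cancel, leaving three equations in `L, N, M`.
  have r1 : L1 * L - t * (w + 4) * N + M1 * M = 0 := by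
    refine (mul_eq_zero.1 (?_ : (t - 1) ^ 2 * _ = 0)).resolve_left (pow_ne_zero 2 ht1)
    rw [hL1, hM1]
    linear_combination h1 - t * h4 + (2 - t ^ 2 - 2 * t) * (h3 - h4)
  have r2 : L2 * L + t * (2 * w - t ^ 2 - 3 * t + 6) * N + M2 * M = 0 := by
    refine (mul_eq_zero.1 (?_ : (t - 1) * _ = 0)).resolve_left ht1
    rw [hL2, hM2]
    linear_combination h2 - t * h4 + (3 - t ^ 2 - 2 * t) * (h3 - h4)
  have r3 : L3 * L + ((t + 1) * w - t ^ 2) * (N + (t + 1) * M) = 0 := by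
    refine (mul_eq_zero.1 (?_ : (t - 1) * _ = 0)).resolve_left ht1
    rw [hL3]
    linear_combination h5 - 2 * h4 - (t + 3) * (h3 - h4)
  have hL : L = 0 := by
    -- The determinant of the reduced system, expanded along the `L` column in `key`.
    have hne : (t - 1) * b1B t w ^ 2 * (((t + 1) * w - t ^ 2) * (w - t * (t + 4))) ≠ 0 :=
      mul_ne_zero (mul_ne_zero ht1 (pow_ne_zero 2 hb)) (mul_ne_zero hneg.ne h.sub_root_neg.ne)
    refine (mul_eq_zero.1 (?_ : _ * L = 0)).resolve_left hne
    have key : (t - 1) * b1B t w ^ 2 * (((t + 1) * w - t ^ 2) * (w - t * (t + 4))) =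
        L1 * (t * (2 * w - t ^ 2 - 3 * t + 6) * ((t + 1) * ((t + 1) * w - t ^ 2))
          - M2 * ((t + 1) * w - t ^ 2))
        - L2 * (-(t * (w + 4)) * ((t + 1) * ((t + 1) * w - t ^ 2)) - M1 * ((t + 1) * w - t ^ 2))
        + L3 * (-(t * (w + 4)) * M2 - M1 * (t * (2 * w - t ^ 2 - 3 * t + 6))) := by
      rw [hL1, hL2, hL3, hM1, hM2, b1B]
      ring
    rw [key]
    linear_combination (t * (2 * w - t ^ 2 - 3 * t + 6) * ((t + 1) * ((t + 1) * w - t ^ 2))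
          - M2 * ((t + 1) * w - t ^ 2)) * r1
        - (-(t * (w + 4)) * ((t + 1) * ((t + 1) * w - t ^ 2)) - M1 * ((t + 1) * w - t ^ 2)) * r2
        + (-(t * (w + 4)) * M2 - M1 * (t * (2 * w - t ^ 2 - 3 * t + 6))) * r3
  subst hL
  have hNM : N + (t + 1) * M = 0 :=
    (mul_eq_zero.1 (by linear_combination r3)).resolve_left hneg.ne
  have hM : M = 0 := by
    have hne : (t + 2) * b1B t w ≠ 0 := mul_ne_zero (by linarith) hb
    refine (mul_eq_zero.1 (?_ : _ * M = 0)).resolve_left hne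
    rw [b1B]
    rw [hM1] at r1
    linear_combination r1 + t * (w + 4) * hNM
  subst hM
  have hN : N = 0 := by linear_combination hNM
  subst hN
  have hA : A = 0 := (mul_eq_zero.1 (by linear_combination h4 - h3)).resolve_left ht0
  subst hA
  have hC : C = 0 := (mul_eq_zero.1 (by linear_combination h4)).resolve_left ht0
  exact ⟨rfl, rfl, rfl, rfl, hC⟩

end ParamB

/-- A quartic form `k` with `√x √y |k| ≤ quinticB` on the orthant vanishes. -/
theorem ParamB.value_eq_zero_of_sqrt_mul_le {t u w p q : ℝ} (h : ParamB t u w p q)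
    (hb : b1B t w ≠ 0) {c : ℕ → ℕ → ℝ} (hc : ∀ x y z, 0 ≤ x → 0 ≤ y → 0 ≤ z →
      √x * √y * |value 4 c x y z| ≤ quinticB w p q x y z) (x y z : ℝ) :
    value 4 c x y z = 0 := by
  have habs (x y z : ℝ) (hx : 0 < x) (hy : 0 < y) (hz : 0 ≤ z) :
      |value 4 c x y z| ≤ quinticB w p q x y z / (√x * √y) := by
    rw [le_div_iff₀ (mul_pos (Real.sqrt_pos.2 hx) (Real.sqrt_pos.2 hy)), mul_comm]
    exact hc x y z hx.le hy.le hz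
  have cx {x y z : ℝ} (hx : 0 < x) (hy : 0 < y) (hz : 0 ≤ z) (h0 : quinticB w p q x y z = 0) :
      value 4 c x y z = 0 ∧ derivX 4 c x y z = 0 :=
    critical_x hx (fun s hs => habs s y z hs hy hz) (by rw [h0, zero_div])
      (DifferentiableAt.div (by unfold quinticB; fun_prop)
        ((Real.hasDerivAt_sqrt hx.ne').differentiableAt.mul_const _)
        (mul_pos (Real.sqrt_pos.2 hx) (Real.sqrt_pos.2 hy)).ne')
  have cy {x y z : ℝ} (hx : 0 < x) (hy : 0 < y) (hz : 0 ≤ z) (h0 : quinticB w p q x y z = 0) :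
      value 4 c x y z = 0 ∧ derivY 4 c x y z = 0 :=
    critical_y hy (fun s hs => habs x s z hx hs hz) (by rw [h0, zero_div])
      (DifferentiableAt.div (by unfold quinticB; fun_prop)
        ((Real.hasDerivAt_sqrt hy.ne').differentiableAt.const_mul _)
        (mul_pos (Real.sqrt_pos.2 hx) (Real.sqrt_pos.2 hy)).ne')
  have cz {x y z : ℝ} (hx : 0 < x) (hy : 0 < y) (hz : 0 < z) (h0 : quinticB w p q x y z = 0) :
      value 4 c x y z = 0 ∧ derivZ 4 c x y z = 0 :=
    critical_z hz (fun s hs => habs x y s hx hy hs.le) (by rw [h0, zero_div])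
      (by unfold quinticB; fun_prop)
  have bx {y z : ℝ} (hy : 0 < y) (hz : 0 ≤ z) (h0 : quinticB w p q 0 y z = 0) :
      value 4 c 0 y z = 0 := by
    have hd : DifferentiableAt ℝ (fun s => value 4 c (s ^ 2) y z) 0 := by
      unfold value; fun_prop
    refine (eq_zero_and_deriv_eq_zero_of_abs_le (s := 0)
      (A := fun s => s * value 4 c (s ^ 2) y z) (A' := value 4 c 0 y z)
      (B := fun s => quinticB w p q (s ^ 2) y z / √y) (Filter.Eventually.of_forall fun s => ?_)
      (by simp [h0]) ?_ (by unfold quinticB; fun_prop)).2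
    · have := hc (s ^ 2) y z (sq_nonneg s) hy.le hz
      rw [le_div_iff₀ (Real.sqrt_pos.2 hy), abs_mul, ← Real.sqrt_sq_eq_abs]
      linarith
    · exact ((hasDerivAt_id (0 : ℝ)).mul hd.hasDerivAt).congr_deriv (by simp)
  have byy {x z : ℝ} (hx : 0 < x) (hz : 0 ≤ z) (h0 : quinticB w p q x 0 z = 0) :
      value 4 c x 0 z = 0 := by
    have hd : DifferentiableAt ℝ (fun s => value 4 c x (s ^ 2) z) 0 := by
      unfold value; fun_prop
    refine (eq_zero_and_deriv_eq_zero_of_abs_le (s := 0)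
      (A := fun s => s * value 4 c x (s ^ 2) z) (A' := value 4 c x 0 z)
      (B := fun s => quinticB w p q x (s ^ 2) z / √x) (Filter.Eventually.of_forall fun s => ?_)
      (by simp [h0]) ?_ (by unfold quinticB; fun_prop)).2
    · have := hc x (s ^ 2) z hx.le (sq_nonneg s) hz
      rw [le_div_iff₀ (Real.sqrt_pos.2 hx), abs_mul, ← Real.sqrt_sq_eq_abs]
      linarith
    · exact ((hasDerivAt_id (0 : ℝ)).mul hd.hasDerivAt).congr_deriv (by simp)
  have hu := h.hu
  have hu' := h.inv_pos
  have z1 := h.quinticB_edge_root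
  have z2 := h.quinticB_edge_root_inv
  -- The quartic on the edge `z = 0` is treated as a quintic with leading coefficient `e5 = 0`.
  obtain ⟨e31, e22, e13, e04⟩ : c 3 1 = 0 - 2 * (w + 2) * c 4 0 ∧
      c 2 2 = -2 * (w + 2) * 0 + (2 + (w + 2) ^ 2) * c 4 0 ∧
      c 1 3 = (2 + (w + 2) ^ 2) * 0 - 2 * (w + 2) * c 4 0 ∧
      c 0 4 = c 4 0 - 2 * (w + 2) * 0 := by
    have h1 := cy one_pos hu le_rfl z1
    have h2 := cy one_pos hu' le_rfl z2
    rw [value_four, derivY_four] at h1 h2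
    exact quintic_coeff_of_double_roots h.mul_inv h.hw h.ne_inv (by linear_combination h1.1)
      (by linear_combination h2.1) (by linear_combination h1.2) (by linear_combination h2.2)
  obtain ⟨e20, e10⟩ : c 2 0 = c 4 0 - (w + 2) * (c 3 0 + (w + 2) * c 4 0) + c 0 0 ∧
      c 1 0 = c 3 0 + (w + 2) * c 4 0 - (w + 2) * c 0 0 := by
    have h1 := byy one_pos hu.le ((quinticB_swap_right ..).trans z1)
    have h2 := byy one_pos hu'.le ((quinticB_swap_right ..).trans z2)
    rw [value_four] at h1 h2
    exact quartic_coeff_of_roots h.mul_inv h.hw h.ne_inv (by linear_combination h1)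
      (by linear_combination h2)
  obtain ⟨e02, e01⟩ : c 0 2 = c 0 4 - (w + 2) * (c 0 3 + (w + 2) * c 0 4) + c 0 0 ∧
      c 0 1 = c 0 3 + (w + 2) * c 0 4 - (w + 2) * c 0 0 := by
    have h1 := bx one_pos hu.le ((quinticB_cycle w p q 0 1 u).symm.trans z1)
    have h2 := bx one_pos hu'.le ((quinticB_cycle w p q 0 1 u⁻¹).symm.trans z2)
    rw [value_four] at h1 h2
    exact quartic_coeff_of_roots h.mul_inv h.hw h.ne_inv (by linear_combination h1)
      (by linear_combination h2)
  have ht : 0 < t := by linarith [h.ht]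
  have t1 := h.quinticB_interior_root
  have t2 : quinticB w p q 1 t 1 = 0 := by rw [quinticB_swap, t1]
  have t3 : quinticB w p q 1 1 t = 0 := by rw [quinticB_cycle, t1]
  obtain ⟨V1, Y1⟩ := cy ht one_pos zero_le_one t1
  obtain ⟨-, Z1⟩ := cz ht one_pos one_pos t1
  obtain ⟨V2, X2⟩ := cx one_pos ht zero_le_one t2
  obtain ⟨V3, X3⟩ := cx one_pos one_pos ht.le t3
  rw [value_four] at V1 V2 V3
  rw [derivX_four] at X2 X3
  rw [derivY_four] at Y1
  rw [derivZ_four] at Z1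
  rw [value_four]
  simp only [e02, e01] at *
  simp only [e31, e22, e13, e20, e10, e04] at *
  obtain ⟨hM, hA⟩ := h.eq_zero_of_quartic_antisym_system
    (M := c 0 3 - c 3 0) (A := c 2 1 - c 1 2)
    (by linear_combination V1 - V2) (by linear_combination Y1 - X2)
  have i1 : c 3 0 = c 0 3 := by linarith
  have i2 : c 1 2 = c 2 1 := by linarith
  simp only [i1, i2] at *
  -- On the edges `x = 0` and `y = 0` the quartic is `s² - (w+2)s + 1` times a quadratic with
  -- coefficients `L, M, N`; this explains the shift in `M`.
  obtain ⟨hL, hN, hM', hA', hC⟩ := h.eq_zero_of_quartic_sym_system hb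
    (L := c 4 0) (N := c 0 0) (M := c 0 3 + (w + 2) * c 4 0) (A := c 2 1) (C := c 1 1)
    (by linear_combination V3) (by linear_combination X3) (by linear_combination V1)
    (by linear_combination Y1) (by linear_combination Z1)
  have i3 : c 0 3 = 0 := by linear_combination hM' - (w + 2) * hL
  rw [hL, hN, hA', hC, i3]
  ring

/-! ### Parity decomposition in degree ten -/

namespace TernaryForm

lemma value_ten_neg (c : ℕ → ℕ → ℝ) (x y z : ℝ) :
    value 10 c (-x) (-y) (-z) = value 10 c x y z := by
  unfold value
  refine Finset.sum_congr rfl fun i hi => Finset.sum_congr rfl fun j hj => ?_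
  rw [Finset.mem_range] at hi hj
  obtain ⟨k, hk⟩ : ∃ k, k = 10 - i - j := ⟨_, rfl⟩
  have h : (-1 : ℝ) ^ i * (-1) ^ j * (-1) ^ k = 1 := by
    rw [← pow_add, ← pow_add, show i + j + k = 10 by omega]
    norm_num
  rw [← hk, neg_pow x, neg_pow y, neg_pow z]
  linear_combination c i j * x ^ i * y ^ j * z ^ k * h

lemma even_part_eq (c : ℕ → ℕ → ℝ) (x y z : ℝ) :
    value 10 c x y z + value 10 c x (-y) z + value 10 c x y (-z) + value 10 c x (-y) (-z) =
      4 * value 5 (fun i j => c (2 * i) (2 * j)) (x ^ 2) (y ^ 2) (z ^ 2) := by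
  simp only [value, Finset.sum_range_succ, Finset.sum_range_zero]
  norm_num
  ring

/-- The signs select odd powers of `y` and even powers of `z`; since the degree is even, the power
of `x` is then odd. -/
lemma odd_part_eq (c : ℕ → ℕ → ℝ) (x y z : ℝ) :
    value 10 c x y z + value 10 c x y (-z) - value 10 c x (-y) z - value 10 c x (-y) (-z) =
      4 * (x * y * value 4 (fun i j => c (2 * i + 1) (2 * j + 1)) (x ^ 2) (y ^ 2) (z ^ 2)) := by
  simp only [value, Finset.sum_range_succ, Finset.sum_range_zero]
  norm_num
  ring

end TernaryForm

namespace ParamB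

variable {t u w p q : ℝ}

/-- The part of a dominated form of degree ten which is odd in the first two variables vanishes. -/
lemma odd_part_eq_zero (h : ParamB t u w p q) (hb : b1B t w ≠ 0) {G : MvPolynomial (Fin 3) ℝ}
    (hG : G ∈ forms 3 10) (hle : ∀ x y z : ℝ, 0 ≤ eval ![x, y, z] G ∧
      eval ![x, y, z] G ≤ quinticB w p q (x ^ 2) (y ^ 2) (z ^ 2)) (x y z : ℝ) :
    eval ![x, y, z] G + eval ![x, y, -z] G - eval ![x, -y, z] G - eval ![x, -y, -z] G = 0 := by
  have he (x y z : ℝ) := eval_eq_value hG ![x, y, z]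
  simp only [Matrix.cons_val_zero, Matrix.cons_val_one, Matrix.cons_val] at he
  simp only [he] at hle ⊢
  rw [odd_part_eq, h.value_eq_zero_of_sqrt_mul_le hb]
  · ring
  · intro x y z hx hy hz
    have h1 := hle √x √y √z
    have h2 := hle √x √y (-√z)
    have h3 := hle √x (-√y) √z
    have h4 := hle √x (-√y) (-√z)
    have h5 := odd_part_eq (fun i j => coeff (exponent i j (10 - i - j)) G) √x √y √z
    simp only [neg_sq, Real.sq_sqrt hx, Real.sq_sqrt hy, Real.sq_sqrt hz] at h1 h2 h3 h4 h5
    rw [← abs_of_nonneg (Real.sqrt_nonneg x), ← abs_of_nonneg (Real.sqrt_nonneg y), ← abs_mul,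
      ← abs_mul, abs_le]
    constructor <;> linarith

/-- A form of degree ten between `0` and the form `quinticB` in the squares of the variables is a
multiple of the latter. -/
lemma eval_eq_of_le (h : ParamB t u w p q) (hb : b1B t w ≠ 0) {G : MvPolynomial (Fin 3) ℝ}
    (hG : G ∈ forms 3 10) (hle : ∀ x y z : ℝ, 0 ≤ eval ![x, y, z] G ∧
      eval ![x, y, z] G ≤ quinticB w p q (x ^ 2) (y ^ 2) (z ^ 2)) :
    ∃ α : ℝ, ∀ x y z : ℝ,
      eval ![x, y, z] G = α * quinticB w p q (x ^ 2) (y ^ 2) (z ^ 2) := by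
  -- Permuting the variables transfers the vanishing of the `xy`-odd part to the other two pairs,
  -- because `quinticB` is symmetric.
  have hren (σ : Fin 3 → Fin 3) : rename σ G ∈ forms 3 10 :=
    MvPolynomial.IsHomogeneous.rename_isHomogeneous hG
  have e1 (x y z : ℝ) : eval ![x, y, z] (rename ![0, 2, 1] G) = eval ![x, z, y] G := by
    rw [eval_rename]
    congr 2
    ext i; fin_cases i <;> rfl
  have e2 (x y z : ℝ) : eval ![x, y, z] (rename ![2, 0, 1] G) = eval ![z, x, y] G := by
    rw [eval_rename]
    congr 2
    ext i; fin_cases i <;> rfl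
  have hxy := h.odd_part_eq_zero hb hG hle
  have hxz := h.odd_part_eq_zero hb (hren ![0, 2, 1]) (fun x y z => by
    rw [e1, ← quinticB_swap_right]; exact hle x z y)
  have hyz := h.odd_part_eq_zero hb (hren ![2, 0, 1]) (fun x y z => by
    rw [e2, quinticB_cycle w p q (z ^ 2)]; exact hle z x y)
  simp only [e1] at hxz
  simp only [e2] at hyz
  have he (x y z : ℝ) := eval_eq_value hG ![x, y, z]
  simp only [Matrix.cons_val_zero, Matrix.cons_val_one, Matrix.cons_val] at he
  obtain ⟨c, hc⟩ : ∃ c : ℕ → ℕ → ℝ, c = fun i j => coeff (exponent i j (10 - i - j)) G :=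
    ⟨_, rfl⟩
  simp only [← hc] at he
  simp only [he] at hle hxy hxz hyz ⊢
  refine ⟨c 10 0, fun x y z => ?_⟩
  have heven := h.value_eq_of_le hb (c := fun i j => c (2 * i) (2 * j)) ?_ (x ^ 2) (y ^ 2) (z ^ 2)
  · have h0 := even_part_eq c x y z
    have h1 := hxy x y z
    have h2 := hxz x z y
    have h3 := hyz y z x
    have h4 := value_ten_neg c x (-y) (-z)
    have h5 := value_ten_neg c x (-y) z
    simp only [neg_neg] at h4 h5
    rw [← heven]
    linarith
  · intro x y z hx hy hz
    have h0 := even_part_eq c √x √y √z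
    have h1 := hle √x √y √z
    have h2 := hle √x √y (-√z)
    have h3 := hle √x (-√y) √z
    have h4 := hle √x (-√y) (-√z)
    simp only [neg_sq, Real.sq_sqrt hx, Real.sq_sqrt hy, Real.sq_sqrt hz] at h0 h1 h2 h3 h4
    constructor <;> linarith

end ParamB

/-! ### Extremality -/

lemma mem_extremalElements {E : Type*} [AddCommGroup E] [Module ℝ E] {P : Set E} {f : E}
    (hf : f ∈ P) (hf0 : f ≠ 0)
    (H : ∀ g ∈ P, ∀ h ∈ P, g + h = f → ∃ α : ℝ, 0 ≤ α ∧ g = α • f) :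
    f ∈ extremalElements P :=
  ⟨hf, hf0, fun g hg h hh e => ⟨H g hg h hh e, H h hh g hg ((add_comm h g).trans e)⟩⟩

lemma eval_vec (f : MvPolynomial (Fin 3) ℝ) (a : Fin 3 → ℝ) :
    eval a f = eval ![a 0, a 1, a 2] f := by
  congr 2
  ext i; fin_cases i <;> rfl

theorem theorem4p28 (t u : ℝ) (ht : 2 ≤ t) (hu : muB t ≤ u) (hu1 : u < 1)
    (hb : b1B t (omega u) ≠ 0) :
    eB t u ∈ extremalElements (psdFormsOrthant 3 5) ∧
      squareVars (eB t u) ∈ extremalElements (psdForms 3 10) := by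
  have h := paramB_of_muB_le ht hu hu1
  have hev := eval_eB t u
  obtain ⟨w, hw⟩ : ∃ w, w = omega u := ⟨_, rfl⟩
  rw [← hw] at h hb hev
  have hone : eval ![1, 0, 0] (eB t u) = 1 := by
    rw [hev]; simp [quinticB]
  have hevS (x y z : ℝ) : eval ![x, y, z] (squareVars (eB t u)) =
      quinticB w (p3B t w) (p4B t w) (x ^ 2) (y ^ 2) (z ^ 2) := by
    rw [eval_squareVars, hev]; rfl
  have honeS : eval ![1, 0, 0] (squareVars (eB t u)) = 1 := by
    rw [hevS]; simp [quinticB]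
  constructor
  · apply mem_extremalElements
    · exact ⟨eB_mem_forms t u, fun a ha => by
        rw [hev]; exact h.quinticB_nonneg (ha 0) (ha 1) (ha 2)⟩
    · intro h0
      simp [h0] at hone
    · intro g hg k hk e
      have hval := eval_eq_value hg.1
      have hvec {x y z : ℝ} (hx : 0 ≤ x) (hy : 0 ≤ y) (hz : 0 ≤ z) : ![x, y, z] ∈ orthant 3 := by
        intro i; fin_cases i <;> assumption
      have key := h.value_eq_of_le hb (c := fun i j => coeff (exponent i j (5 - i - j)) g)
        fun x y z hx hy hz => by
          have h1 := hg.2 _ (hvec hx hy hz)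
          have h2 := hk.2 _ (hvec hx hy hz)
          have h3 := hev ![x, y, z]
          rw [← e, map_add] at h3
          have h4 := hval ![x, y, z]
          simp only [Matrix.cons_val_zero, Matrix.cons_val_one, Matrix.cons_val] at h3 h4
          rw [← h4]
          exact ⟨h1, by linarith⟩
      have hg' : g = coeff (exponent 5 0 0) g • eB t u := by
        apply MvPolynomial.funext
        intro a
        rw [hval, key, smul_eval, hev]
      -- The factor is the coefficient of `x⁵`, nonnegative by evaluation at `(1, 0, 0)`, where the
      -- form equals `1`.
      refine ⟨_, ?_, hg'⟩
      have h1 := hg.2 _ (hvec zero_le_one le_rfl le_rfl)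
      rw [hg', smul_eval, hone, mul_one] at h1
      exact h1
  · apply mem_extremalElements
    · refine ⟨squareVars_mem_forms (eB_mem_forms t u), fun a _ => ?_⟩
      rw [eval_vec, hevS]
      exact h.quinticB_nonneg (sq_nonneg _) (sq_nonneg _) (sq_nonneg _)
    · intro h0
      simp [h0] at honeS
    · intro g hg k hk e
      obtain ⟨α, hα⟩ := h.eval_eq_of_le hb hg.1 fun x y z => by
        have h1 := hg.2 ![x, y, z] trivial
        have h2 := hk.2 ![x, y, z] trivial
        have h3 := hevS x y z
        rw [← e, map_add] at h3
        exact ⟨h1, by linarith⟩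
      refine ⟨α, ?_, ?_⟩
      · have h1 := hg.2 ![1, 0, 0] trivial
        rw [hα, ← hevS, honeS, mul_one] at h1
        exact h1
      · apply MvPolynomial.funext
        intro a
        rw [eval_vec g, smul_eval, eval_vec (squareVars _), hevS, hα]
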